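/- Let $M\in\mathbb R$ and $0<\lambda\le\Lambda$. There exist constants $\varepsilon>0$ and $C>0$, depending only on $(M,\lambda,\Lambda)$, such that the following holds. Let $K:\mathbb R^2\to\mathbb R$ be measurable with $\lambda\le K\le\Lambda$ almost everywhere, and let $u:\mathbb R^2\to\mathbb R$ be a locally integrable function with $u\le M$ almost everywhere which solves $\Delta u+K e^{2u}=0$ on $\mathbb R^2$ in the sense of distributions, i.e. $\int_{\mathbb R^2}u\,\Delta\varphi\,dx+\int_{\mathbb R^2}K e^{2u}\varphi\,dx=0$ for all $\varphi\in C_c^\infty(\mathbb R^2)$. For $x\in\mathbb R^2$ and $R>0$ put $Q_R(x)=x+[-\tfrac R2,\tfrac R2]^2$. Then $$\sup_{x\in\mathbb R^2}\frac1{|Q_R(x)|}\int_{Q_R(x)}e^{2u}\,dy\le C R^{-\varepsilon}\qquad\text{for all }R\ge1.$$ Consequently, with $B_R$ the disc of radius $R$ centered at the origin and with the same $\varepsilon$, $\int_{B_R}e^{2u}\,dx=O(R^{2-\varepsilon})$ as $R\to\infty$. -/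

import Mathlib

open MeasureTheory Filter
open scoped ENNReal ContDiff

/-- The Euclidean plane `ℝ²`. -/
abbrev Plane : Type := EuclideanSpace ℝ (Fin 2)

/-- `u` is an entire solution of `Δu + K e^{2u} = 0` on `ℝ²`, in the sense of distributions:
both terms are locally integrable and the equation holds against every smooth, compactly
supported test function `φ`, the Laplacian being moved onto `φ`. -/
structure IsEntireSolution (K u : Plane → ℝ) : Prop where
  locallyIntegrable : LocallyIntegrable u volume
  locallyIntegrable_rhs : LocallyIntegrable (fun x => K x * Real.exp (2 * u x)) volume
  equation : ∀ φ : Plane → ℝ, ContDiff ℝ ∞ φ → HasCompactSupport φ →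
    (∫ x, u x * Laplacian.laplacian φ x) + (∫ x, K x * Real.exp (2 * u x) * φ x) = 0

/-- The closed square `Q_R(x) = x + [-R/2, R/2]²`, of side length `R` and center `x`. -/
def square (R : ℝ) (x : Plane) : Set Plane :=
  {y | ∀ i, y i - x i ∈ Set.Icc (-(R / 2)) (R / 2)}

/-- The area density `𝒟_u(Ω) = |Ω|⁻¹ ∫_Ω e^{2u} dx`, as an extended nonnegative real. -/
noncomputable def areaDensity (u : Plane → ℝ) (Ω : Set Plane) : ℝ≥0∞ :=
  (∫⁻ x in Ω, ENNReal.ofReal (Real.exp (2 * u x))) / volume Ω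

/-- The global density `δ_u(R) = sup_x 𝒟_u(Q_R(x))` at squares of side length `R`. -/
noncomputable def globalDensity (u : Plane → ℝ) (R : ℝ) : ℝ≥0∞ :=
  ⨆ x : Plane, areaDensity u (square R x)

/-!
The solution enters only through `v = M - u ≥ 0`, which satisfies `Δv = f` with
`f = K e^{2u}` comparable to `e^{2u}`. Let `d k` be the largest density of `e^{2u}` on squares of
side `2 ^ k`; it is nonincreasing in `k`. Fix `k` and suppose that `d k` is not small, neither
compared to `2 ^ (-k)` nor to the densities at smaller scales (`2 ^ j * d j ≤ 2 ^ k * d k`). We show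
that, for a fixed number `n`, every square of side `2 ^ (k + n)` has density at most
`(1 - c) * d k` (`IsBoundedSolution.dyadicDensity_trichotomy`). Together with
`exists_geometric_bound` this gives geometric decay of `d k`, which is the theorem.

Otherwise there is a square of side `S = 2 ^ (k + n)` whose density is so close to `d k` that *all*
its dyadic subsquares of side `R = 2 ^ k` have density at least `d k / 2`. Two estimates of
`∫ v` over the large square then contradict each other for large `n`.

* Each subsquare contains a point `p` with `e^{2u(p)} ≥ d k / 4`, so that `v(p)` is at most of
  logarithmic size. The growth of the means of `v` around `p` from scale zero to scale `R` is the
  sum over dyadic scales of the mass of `f`, which by the assumption on smaller scales is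
  `O(R² d k)`.
  Hence the mean of `v` on every subsquare, and so on the large square, is `O(R² d k)`
  (`IsBoundedSolution.setIntegral_le_of_dense`).
* The mass of `f` makes the mean of `v` at scale `S` at least of order `S² d k`
  (`IsBoundedSolution.le_setIntegral_of_nearly_extremal`).

The means are taken with respect to a smooth compactly supported radial kernel. The difference of
the kernels at scales `2r` and `r` is the Laplacian of a nonnegative smooth compactly supported
function, so the mean value formula `smoothMean_two_mul` is just the equation tested against it.
-/

/-! ### A radial kernel and its potential -/

/-- A smooth function equal to `t` for `t ≥ 2` and constant for `t ≤ 1`: a smooth regularization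
of `max t 1`, up to the value of the constant. -/
noncomputable def smoothMax (t : ℝ) : ℝ :=
  2 - ∫ s in t..2, Real.smoothTransition (s - 1)

lemma continuous_smoothTransition_sub_one :
    Continuous fun s : ℝ => Real.smoothTransition (s - 1) :=
  Real.smoothTransition.continuous.comp (continuous_id.sub continuous_const)

lemma contDiff_smoothTransition_sub_one :
    ContDiff ℝ ∞ fun s : ℝ => Real.smoothTransition (s - 1) :=
  (Real.smoothTransition.contDiff (n := ⊤)).comp (contDiff_id.sub contDiff_const)

lemma hasDerivAt_smoothMax (t : ℝ) :
    HasDerivAt smoothMax (Real.smoothTransition (t - 1)) t := by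
  have h := intervalIntegral.integral_hasDerivAt_left
    (continuous_smoothTransition_sub_one.intervalIntegrable t 2)
    (continuous_smoothTransition_sub_one.stronglyMeasurableAtFilter _ _)
    continuous_smoothTransition_sub_one.continuousAt
  exact (h.const_sub 2).congr_deriv (neg_neg _)

lemma contDiff_smoothMax : ContDiff ℝ ∞ smoothMax := by
  refine contDiff_infty_iff_deriv.2 ⟨fun t => (hasDerivAt_smoothMax t).differentiableAt, ?_⟩
  rw [show deriv smoothMax = fun t => Real.smoothTransition (t - 1) from
    funext fun t => (hasDerivAt_smoothMax t).deriv]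
  exact contDiff_smoothTransition_sub_one

lemma monotone_smoothMax : Monotone smoothMax :=
  monotone_of_deriv_nonneg (fun t => (hasDerivAt_smoothMax t).differentiableAt)
    fun t => by rw [(hasDerivAt_smoothMax t).deriv]; exact Real.smoothTransition.nonneg _

lemma smoothMax_eq_self {t : ℝ} (ht : 2 ≤ t) : smoothMax t = t := by
  have : ∫ s in t..2, Real.smoothTransition (s - 1) = ∫ s in t..2, (1 : ℝ) := by
    refine intervalIntegral.integral_congr fun s hs => ?_
    rw [Set.uIcc_of_ge ht] at hs
    exact Real.smoothTransition.one_of_one_le (by linarith [hs.1])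
  rw [smoothMax, this]; simp

lemma smoothMax_le_two {t : ℝ} (ht : t ≤ 2) : smoothMax t ≤ 2 :=
  (monotone_smoothMax ht).trans_eq (smoothMax_eq_self le_rfl)

lemma le_smoothMax (t : ℝ) : t ≤ smoothMax t := by
  rcases le_total 2 t with h | h
  · exact (smoothMax_eq_self h).ge
  · have : ∫ s in t..2, Real.smoothTransition (s - 1) ≤ ∫ s in t..2, (1 : ℝ) :=
      intervalIntegral.integral_mono_on h
        (continuous_smoothTransition_sub_one.intervalIntegrable _ _) (by simp)
        fun s _ => Real.smoothTransition.le_one _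
    simp only [intervalIntegral.integral_const, smul_eq_mul, mul_one] at this
    rw [smoothMax]; linarith

lemma one_le_smoothMax (t : ℝ) : 1 ≤ smoothMax t := by
  rcases le_total 1 t with h | h
  · exact h.trans (le_smoothMax t)
  · have : ∫ s in t..1, Real.smoothTransition (s - 1) = ∫ s in t..1, (0 : ℝ) := by
      refine intervalIntegral.integral_congr fun s hs => ?_
      rw [Set.uIcc_of_le h] at hs
      exact Real.smoothTransition.zero_of_nonpos (by linarith [hs.2])
    have h1 := le_smoothMax 1
    rw [smoothMax] at h1 ⊢
    rw [← intervalIntegral.integral_add_adjacent_intervals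
      (continuous_smoothTransition_sub_one.intervalIntegrable t 1)
      (continuous_smoothTransition_sub_one.intervalIntegrable 1 2), this]
    simpa using h1

lemma smoothMax_pos (t : ℝ) : 0 < smoothMax t := zero_lt_one.trans_le (one_le_smoothMax t)

/-- A smooth function on the line, equal to `(1/2) log t` up to an additive constant for `t ≥ 2`.
Hence `x ↦ logProfile (‖x‖ ^ 2)` is the logarithmic potential of a smooth radial density. -/
noncomputable def logProfile (t : ℝ) : ℝ := ∫ s in (0 : ℝ)..t, (2 * smoothMax s)⁻¹

lemma contDiff_inv_two_mul_smoothMax : ContDiff ℝ ∞ fun s => (2 * smoothMax s)⁻¹ :=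
  (contDiff_const.mul contDiff_smoothMax).inv fun s => by have := smoothMax_pos s; positivity

lemma hasDerivAt_logProfile (t : ℝ) : HasDerivAt logProfile (2 * smoothMax t)⁻¹ t :=
  intervalIntegral.integral_hasDerivAt_right
    (contDiff_inv_two_mul_smoothMax.continuous.intervalIntegrable 0 t)
    (contDiff_inv_two_mul_smoothMax.continuous.stronglyMeasurableAtFilter _ _)
    contDiff_inv_two_mul_smoothMax.continuous.continuousAt

lemma contDiff_logProfile : ContDiff ℝ ∞ logProfile := by
  refine contDiff_infty_iff_deriv.2 ⟨fun t => (hasDerivAt_logProfile t).differentiableAt, ?_⟩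
  rw [show deriv logProfile = fun t => (2 * smoothMax t)⁻¹ from
    funext fun t => (hasDerivAt_logProfile t).deriv]
  exact contDiff_inv_two_mul_smoothMax

lemma hasDerivAt_inv_two_mul_smoothMax (t : ℝ) :
    HasDerivAt (fun s => (2 * smoothMax s)⁻¹)
      (-(Real.smoothTransition (t - 1) / (2 * smoothMax t ^ 2))) t := by
  have h := ((hasDerivAt_smoothMax t).const_mul 2).inv
    (by have := smoothMax_pos t; positivity)
  refine h.congr_deriv ?_
  have := (smoothMax_pos t).ne'
  field_simp

/-- The radial profile of the averaging kernel: `x ↦ averagingProfile (‖x‖ ^ 2)` is the Laplacian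
of `x ↦ logProfile (‖x‖ ^ 2)` on the plane. -/
noncomputable def averagingProfile (t : ℝ) : ℝ :=
  2 * (smoothMax t - t * Real.smoothTransition (t - 1)) / smoothMax t ^ 2

lemma continuous_averagingProfile : Continuous averagingProfile := by
  have h := contDiff_smoothMax.continuous
  have h' := continuous_smoothTransition_sub_one
  unfold averagingProfile
  exact Continuous.div (by fun_prop) (by fun_prop) fun t => (pow_pos (smoothMax_pos t) 2).ne'

lemma averagingProfile_nonneg {t : ℝ} (ht : 0 ≤ t) : 0 ≤ averagingProfile t := by
  have h1 := le_smoothMax t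
  have h2 := mul_le_mul_of_nonneg_left (Real.smoothTransition.le_one (t - 1)) ht
  unfold averagingProfile
  exact div_nonneg (by linarith) (by positivity)

lemma averagingProfile_le_two {t : ℝ} (ht : 0 ≤ t) : averagingProfile t ≤ 2 := by
  have h1 := one_le_smoothMax t
  have h2 := mul_nonneg ht (Real.smoothTransition.nonneg (t - 1))
  unfold averagingProfile
  rw [div_le_iff₀ (by positivity)]
  nlinarith

lemma averagingProfile_eq_zero {t : ℝ} (ht : 2 ≤ t) : averagingProfile t = 0 := by
  simp [averagingProfile, smoothMax_eq_self ht,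
    Real.smoothTransition.one_of_one_le (show 1 ≤ t - 1 by linarith)]

lemma one_le_averagingProfile {t : ℝ} (ht : t ≤ 1) : 1 ≤ averagingProfile t := by
  have h1 := smoothMax_pos t
  have h2 := smoothMax_le_two (show t ≤ 2 by linarith)
  rw [averagingProfile, Real.smoothTransition.zero_of_nonpos (by linarith),
    le_div_iff₀ (by positivity)]
  nlinarith

/-- The radial profile of the potential of the difference of the averaging kernels at scales `1`
and `2`; it is smooth and compactly supported. -/
noncomputable def potentialProfile (t : ℝ) : ℝ :=
  Real.log 2 - logProfile t + logProfile (t / 4)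

lemma contDiff_potentialProfile : ContDiff ℝ ∞ potentialProfile :=
  (contDiff_const.sub contDiff_logProfile).add
    (contDiff_logProfile.comp (contDiff_id.div_const 4))

lemma potentialProfile_eq (t : ℝ) :
    potentialProfile t = Real.log 2 - ∫ s in (t / 4)..t, (2 * smoothMax s)⁻¹ := by
  have h := contDiff_inv_two_mul_smoothMax.continuous
  rw [potentialProfile, logProfile, logProfile,
    ← intervalIntegral.integral_interval_sub_left (h.intervalIntegrable 0 t)
      (h.intervalIntegrable 0 (t / 4))]
  ring

lemma integral_inv_two_mul_quarter {t : ℝ} (ht : 0 < t) :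
    ∫ s in (t / 4)..t, (2 * s)⁻¹ = Real.log 2 := by
  simp_rw [mul_inv]
  rw [intervalIntegral.integral_const_mul, integral_inv_of_pos (by positivity) ht,
    show t / (t / 4) = 2 ^ 2 by field_simp; norm_num, Real.log_pow]
  push_cast; ring

lemma intervalIntegrable_inv_two_mul_quarter {t : ℝ} (ht : 0 < t) :
    IntervalIntegrable (fun s : ℝ => (2 * s)⁻¹) volume (t / 4) t := by
  refine ContinuousOn.intervalIntegrable fun s hs => ?_
  rw [Set.uIcc_of_le (by linarith)] at hs
  have : (2 * s) ≠ 0 := by have := hs.1; linarith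
  exact ((continuousAt_const.mul continuousAt_id).inv₀ this).continuousWithinAt

lemma potentialProfile_nonneg {t : ℝ} (ht : 0 ≤ t) : 0 ≤ potentialProfile t := by
  rcases ht.eq_or_lt with rfl | ht
  · simp [potentialProfile_eq, Real.log_nonneg]
  · have h : ∫ s in (t / 4)..t, (2 * smoothMax s)⁻¹ ≤ ∫ s in (t / 4)..t, (2 * s)⁻¹ := by
      refine intervalIntegral.integral_mono_on (by linarith)
        (contDiff_inv_two_mul_smoothMax.continuous.intervalIntegrable _ _)
        (intervalIntegrable_inv_two_mul_quarter ht) fun s hs => ?_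
      have : 0 < s := by linarith [hs.1]
      have := le_smoothMax s
      gcongr
    rw [integral_inv_two_mul_quarter ht] at h
    rw [potentialProfile_eq]; linarith

lemma potentialProfile_le_one {t : ℝ} (ht : 0 ≤ t) : potentialProfile t ≤ 1 := by
  have h : 0 ≤ ∫ s in (t / 4)..t, (2 * smoothMax s)⁻¹ :=
    intervalIntegral.integral_nonneg (by linarith) fun s _ => by
      have := smoothMax_pos s; positivity
  rw [potentialProfile_eq]
  linarith [Real.log_two_lt_d9]

lemma potentialProfile_eq_zero {t : ℝ} (ht : 8 ≤ t) : potentialProfile t = 0 := by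
  have h : ∫ s in (t / 4)..t, (2 * smoothMax s)⁻¹ = ∫ s in (t / 4)..t, (2 * s)⁻¹ := by
    refine intervalIntegral.integral_congr fun s hs => ?_
    rw [Set.uIcc_of_le (by linarith)] at hs
    simp only [smoothMax_eq_self (show 2 ≤ s by linarith [hs.1])]
  rw [potentialProfile_eq, h, integral_inv_two_mul_quarter (by linarith), sub_self]

lemma quarter_le_potentialProfile {t : ℝ} (h0 : 0 ≤ t) (ht : t ≤ 1) :
    1 / 4 ≤ potentialProfile t := by
  have h : ∫ s in (t / 4)..t, (2 * smoothMax s)⁻¹ ≤ ∫ s in (t / 4)..t, (2 : ℝ)⁻¹ := by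
    refine intervalIntegral.integral_mono_on (by linarith)
      (contDiff_inv_two_mul_smoothMax.continuous.intervalIntegrable _ _) (by simp) fun s hs => ?_
    have := one_le_smoothMax s
    gcongr
    linarith
  simp only [intervalIntegral.integral_const, smul_eq_mul] at h
  rw [potentialProfile_eq]
  linarith [Real.log_two_gt_d9]

lemma hasDerivAt_potentialProfile (t : ℝ) :
    HasDerivAt potentialProfile (-(2 * smoothMax t)⁻¹ + (2 * smoothMax (t / 4))⁻¹ / 4) t := by
  have h1 := (hasDerivAt_logProfile t).const_sub (Real.log 2)
  have h2 := (hasDerivAt_logProfile (t / 4)).comp t ((hasDerivAt_id t).div_const 4)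
  exact (h1.add h2).congr_deriv (by ring)

lemma hasDerivAt_deriv_potentialProfile (t : ℝ) :
    HasDerivAt (deriv potentialProfile)
      (Real.smoothTransition (t - 1) / (2 * smoothMax t ^ 2)
        - Real.smoothTransition (t / 4 - 1) / (2 * smoothMax (t / 4) ^ 2) / 16) t := by
  rw [show deriv potentialProfile = fun t => -(2 * smoothMax t)⁻¹ + (2 * smoothMax (t / 4))⁻¹ / 4
    from funext fun t => (hasDerivAt_potentialProfile t).deriv]
  have h1 := (hasDerivAt_inv_two_mul_smoothMax t).neg
  have h2 := ((hasDerivAt_inv_two_mul_smoothMax (t / 4)).comp t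
    ((hasDerivAt_id t).div_const 4)).div_const 4
  exact (h1.add h2).congr_deriv (by ring)

lemma laplacian_potentialProfile (t : ℝ) :
    4 * deriv potentialProfile t + 4 * t * deriv (deriv potentialProfile) t
      = averagingProfile (t / 4) / 4 - averagingProfile t := by
  rw [(hasDerivAt_potentialProfile t).deriv, (hasDerivAt_deriv_potentialProfile t).deriv,
    averagingProfile, averagingProfile]
  have h1 := (smoothMax_pos t).ne'
  have h2 := (smoothMax_pos (t / 4)).ne'
  field_simp
  ring

/-- The Laplacian on the plane of a radial function, written as a function of `‖y - p‖ ^ 2`. -/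
lemma laplacian_radial {F : ℝ → ℝ} (hF : ContDiff ℝ ∞ F) (p y : Plane) :
    Laplacian.laplacian (fun z : Plane => F (‖z - p‖ ^ 2)) y
      = 4 * deriv F (‖y - p‖ ^ 2) + 4 * ‖y - p‖ ^ 2 * deriv (deriv F) (‖y - p‖ ^ 2) := by
  have hF1 : Differentiable ℝ F := hF.differentiable (by simp)
  have hF2 : Differentiable ℝ (deriv F) :=
    (contDiff_infty_iff_deriv.1 hF).2.differentiable (by simp)
  have hsq (z : Plane) : HasFDerivAt (fun z : Plane => ‖z - p‖ ^ 2)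
      ((2 : ℝ) • innerSL ℝ (z - p)) z := by
    refine ((hasFDerivAt_id z).sub_const p).norm_sq.congr_fderiv ?_
    ext w
    simp
  have h1 : fderiv ℝ (fun z : Plane => F (‖z - p‖ ^ 2))
      = fun z => (2 * deriv F (‖z - p‖ ^ 2)) • innerSL ℝ (z - p) := by
    funext z
    have h := ((hF1 (‖z - p‖ ^ 2)).hasDerivAt.comp_hasFDerivAt z (hsq z)).fderiv
    simp only [Function.comp_def] at h
    rw [h, smul_smul, mul_comm]
  have h2 (z : Plane) : HasFDerivAt (fun z : Plane => innerSL ℝ (z - p)) (innerSL ℝ) z :=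
    (innerSL ℝ).hasFDerivAt.comp z ((hasFDerivAt_id z).sub_const p)
  have h3 := (((hF2 (‖y - p‖ ^ 2)).hasDerivAt.comp_hasFDerivAt y (hsq y)).const_mul 2).smul (h2 y)
  have h4 : fderiv ℝ (fun z : Plane => (2 * deriv F (‖z - p‖ ^ 2)) • innerSL ℝ (z - p)) y = _ :=
    h3.fderiv
  rw [InnerProductSpace.laplacian_eq_iteratedFDeriv_orthonormalBasis _
    (EuclideanSpace.basisFun (Fin 2) ℝ)]
  simp only [iteratedFDeriv_two_apply, h1]
  have hn : ‖y - p‖ ^ 2 = (y 0 - p 0) ^ 2 + (y 1 - p 1) ^ 2 := by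
    rw [EuclideanSpace.norm_sq_eq]
    simp [Fin.sum_univ_two]
  -- The inner product appears here as a linear map, not as a `starRingEnd ℝ`-semilinear one.
  have hb (i : Fin 2) : (innerSL ℝ : Plane →L[ℝ] Plane →L[ℝ] ℝ)
      (EuclideanSpace.single i (1 : ℝ)) (EuclideanSpace.single i 1) = 1 :=
    (innerSL_apply_apply ℝ _ _).trans (by simp)
  rw [h4]
  simp [Fin.sum_univ_two, EuclideanSpace.inner_single_right, EuclideanSpace.basisFun_apply]
  rw [hb 0, hb 1]
  linear_combination (-4 * deriv (deriv F) (‖y - p‖ ^ 2)) * hn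

/-! ### Smooth means and the mean value formula -/

/-- The averaging kernel at scale `r` around `p`; its total mass does not depend on `r`. -/
noncomputable def avgKernel (r : ℝ) (p y : Plane) : ℝ :=
  averagingProfile (‖y - p‖ ^ 2 / r ^ 2) / r ^ 2

/-- The potential kernel at scale `r` around `p`, whose Laplacian is
`avgKernel (2 * r) p - avgKernel r p`. -/
noncomputable def potKernel (r : ℝ) (p y : Plane) : ℝ := potentialProfile (‖y - p‖ ^ 2 / r ^ 2)

/-- The (unnormalized) smooth mean of `v` at scale `r` around `p`. -/
noncomputable def smoothMean (v : Plane → ℝ) (r : ℝ) (p : Plane) : ℝ := ∫ y, v y * avgKernel r p y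

lemma avgKernel_nonneg (r : ℝ) (p y : Plane) : 0 ≤ avgKernel r p y :=
  div_nonneg (averagingProfile_nonneg (by positivity)) (by positivity)

lemma avgKernel_le (r : ℝ) (p y : Plane) : avgKernel r p y ≤ 2 / r ^ 2 :=
  div_le_div_of_nonneg_right (averagingProfile_le_two (by positivity)) (by positivity)

lemma avgKernel_eq_zero {r : ℝ} (hr : 0 < r) {p y : Plane} (h : 2 * r ^ 2 ≤ ‖y - p‖ ^ 2) :
    avgKernel r p y = 0 := by
  rw [avgKernel, averagingProfile_eq_zero, zero_div]
  rwa [le_div_iff₀ (by positivity)]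

lemma le_avgKernel {r : ℝ} (hr : 0 < r) {p y : Plane} (h : ‖y - p‖ ^ 2 ≤ r ^ 2) :
    1 / r ^ 2 ≤ avgKernel r p y := by
  refine div_le_div_of_nonneg_right (one_le_averagingProfile ?_) (by positivity)
  exact div_le_one_of_le₀ h (by positivity)

lemma continuous_avgKernel (r : ℝ) (p : Plane) : Continuous (avgKernel r p) := by
  have := continuous_averagingProfile
  unfold avgKernel
  fun_prop

lemma hasCompactSupport_avgKernel {r : ℝ} (hr : 0 < r) (p : Plane) :
    HasCompactSupport (avgKernel r p) := by
  refine HasCompactSupport.intro (isCompact_closedBall p (2 * r)) fun y hy => ?_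
  refine avgKernel_eq_zero hr ?_
  rw [Metric.mem_closedBall, dist_eq_norm, not_le] at hy
  nlinarith [norm_nonneg (y - p)]

lemma potKernel_nonneg (r : ℝ) (p y : Plane) : 0 ≤ potKernel r p y :=
  potentialProfile_nonneg (by positivity)

lemma potKernel_le_one (r : ℝ) (p y : Plane) : potKernel r p y ≤ 1 :=
  potentialProfile_le_one (by positivity)

lemma potKernel_eq_zero {r : ℝ} (hr : 0 < r) {p y : Plane} (h : 8 * r ^ 2 ≤ ‖y - p‖ ^ 2) :
    potKernel r p y = 0 := by
  rw [potKernel, potentialProfile_eq_zero]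
  rwa [le_div_iff₀ (by positivity)]

lemma le_potKernel {r : ℝ} {p y : Plane} (h : ‖y - p‖ ^ 2 ≤ r ^ 2) : 1 / 4 ≤ potKernel r p y :=
  quarter_le_potentialProfile (by positivity) (div_le_one_of_le₀ h (by positivity))

lemma contDiff_potKernel (r : ℝ) (p : Plane) : ContDiff ℝ ∞ (potKernel r p) :=
  contDiff_potentialProfile.comp (((contDiff_id.sub contDiff_const).norm_sq ℝ).div_const _)

lemma hasCompactSupport_potKernel {r : ℝ} (hr : 0 < r) (p : Plane) :
    HasCompactSupport (potKernel r p) := by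
  refine HasCompactSupport.intro (isCompact_closedBall p (3 * r)) fun y hy => ?_
  refine potKernel_eq_zero hr ?_
  rw [Metric.mem_closedBall, dist_eq_norm, not_le] at hy
  nlinarith [norm_nonneg (y - p)]

lemma laplacian_potKernel {r : ℝ} (hr : 0 < r) (p y : Plane) :
    Laplacian.laplacian (potKernel r p) y = avgKernel (2 * r) p y - avgKernel r p y := by
  have hF : ContDiff ℝ ∞ fun t : ℝ => potentialProfile (t / r ^ 2) :=
    contDiff_potentialProfile.comp (contDiff_id.div_const _)
  have hd : deriv (fun t : ℝ => potentialProfile (t / r ^ 2))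
      = fun t => deriv potentialProfile (t / r ^ 2) / r ^ 2 := by
    funext t
    have h := (hasDerivAt_potentialProfile (t / r ^ 2)).comp t ((hasDerivAt_id t).div_const (r ^ 2))
    rw [← (hasDerivAt_potentialProfile (t / r ^ 2)).deriv] at h
    exact h.deriv.trans (by ring)
  have hdd (t : ℝ) : deriv (fun t => deriv potentialProfile (t / r ^ 2) / r ^ 2) t
      = deriv (deriv potentialProfile) (t / r ^ 2) / r ^ 2 / r ^ 2 := by
    have h := ((hasDerivAt_deriv_potentialProfile (t / r ^ 2)).comp t
      ((hasDerivAt_id t).div_const (r ^ 2))).div_const (r ^ 2)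
    rw [← (hasDerivAt_deriv_potentialProfile (t / r ^ 2)).deriv] at h
    exact h.deriv.trans (by ring)
  have h := laplacian_radial hF p y
  rw [hd] at h
  simp only [hdd] at h
  have key := laplacian_potentialProfile (‖y - p‖ ^ 2 / r ^ 2)
  have e : ‖y - p‖ ^ 2 / (2 * r) ^ 2 = ‖y - p‖ ^ 2 / r ^ 2 / 4 := by field_simp; norm_num
  rw [show potKernel r p = fun z => potentialProfile (‖z - p‖ ^ 2 / r ^ 2) from rfl, h, avgKernel,
    avgKernel, e,
    show averagingProfile (‖y - p‖ ^ 2 / r ^ 2 / 4) / (2 * r) ^ 2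
      = averagingProfile (‖y - p‖ ^ 2 / r ^ 2 / 4) / 4 / r ^ 2 by
        field_simp; ring,
    ← sub_div, ← key]
  ring

/-- The total mass of the averaging kernels. -/
noncomputable def kernelMass : ℝ := ∫ y : Plane, averagingProfile (‖y‖ ^ 2)

lemma kernelMass_nonneg : 0 ≤ kernelMass :=
  integral_nonneg fun _ => averagingProfile_nonneg (by positivity)

lemma integral_avgKernel {r : ℝ} (hr : 0 < r) (p : Plane) : ∫ y, avgKernel r p y = kernelMass := by
  have h1 : ∫ y, avgKernel r p y = ∫ y, avgKernel r 0 y := by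
    rw [← integral_sub_right_eq_self (avgKernel r 0) p]
    simp [avgKernel]
  have h2 := Measure.integral_comp_inv_smul_of_nonneg (volume : Measure Plane)
    (fun y : Plane => averagingProfile (‖y‖ ^ 2)) hr.le
  rw [h1, kernelMass]
  simp only [finrank_euclideanSpace, Fintype.card_fin, smul_eq_mul] at h2
  have e (y : Plane) : avgKernel r 0 y = averagingProfile (‖r⁻¹ • y‖ ^ 2) / r ^ 2 := by
    rw [avgKernel, sub_zero, norm_smul, mul_pow, norm_inv, inv_pow, Real.norm_eq_abs, sq_abs,
      div_eq_inv_mul (‖y‖ ^ 2)]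
  simp_rw [e]
  rw [integral_div, h2]
  field_simp

lemma integrable_mul_avgKernel {v : Plane → ℝ} (hv : LocallyIntegrable v volume) {r : ℝ}
    (hr : 0 < r) (p : Plane) : Integrable (fun y => v y * avgKernel r p y) volume := by
  have h := hv.integrable_smul_left_of_hasCompactSupport (continuous_avgKernel r p)
    (hasCompactSupport_avgKernel hr p)
  simpa [mul_comm] using h

lemma integrable_mul_potKernel {f : Plane → ℝ} (hf : LocallyIntegrable f volume) {r : ℝ}
    (hr : 0 < r) (p : Plane) : Integrable (fun y => f y * potKernel r p y) volume := by
  have h := hf.integrable_smul_left_of_hasCompactSupport (contDiff_potKernel r p).continuous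
    (hasCompactSupport_potKernel hr p)
  simpa [mul_comm] using h

lemma integrable_avgKernel {r : ℝ} (hr : 0 < r) (p : Plane) :
    Integrable (avgKernel r p) volume :=
  (continuous_avgKernel r p).integrable_of_hasCompactSupport (hasCompactSupport_avgKernel hr p)

lemma smoothMean_const_sub {u : Plane → ℝ} (hu : LocallyIntegrable u volume) (M : ℝ) {r : ℝ}
    (hr : 0 < r) (p : Plane) :
    smoothMean (fun y => M - u y) r p = M * kernelMass - smoothMean u r p := by
  simp only [smoothMean, sub_mul]
  rw [integral_sub ((integrable_avgKernel hr p).const_mul M) (integrable_mul_avgKernel hu hr p),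
    integral_const_mul, integral_avgKernel hr]

/-- **Mean value formula**: doubling the scale increases the smooth mean of `M - u` by the
potential of the density `K e^{2u}`. -/
lemma smoothMean_two_mul {K u : Plane → ℝ} (h : IsEntireSolution K u) (M : ℝ) {r : ℝ}
    (hr : 0 < r) (p : Plane) :
    smoothMean (fun y => M - u y) (2 * r) p = smoothMean (fun y => M - u y) r p
      + ∫ y, K y * Real.exp (2 * u y) * potKernel r p y := by
  have e := h.equation _ (contDiff_potKernel r p) (hasCompactSupport_potKernel hr p)
  have h2 : 0 < 2 * r := by positivity
  simp only [laplacian_potKernel hr, mul_sub] at e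
  rw [integral_sub (integrable_mul_avgKernel h.locallyIntegrable h2 p)
    (integrable_mul_avgKernel h.locallyIntegrable hr p)] at e
  rw [smoothMean_const_sub h.locallyIntegrable M h2, smoothMean_const_sub h.locallyIntegrable M hr,
    smoothMean, smoothMean]
  linarith

lemma abs_smoothMean_sub_le {v : Plane → ℝ} (hv : LocallyIntegrable v volume) {r : ℝ}
    (hr : 0 < r) (p : Plane) :
    |smoothMean v r p - v p * kernelMass|
      ≤ (8 * Real.pi) * ⨍ y in Metric.closedBall p (2 * r), ‖v y - v p‖ := by
  have hvol : volume.real (Metric.closedBall p (2 * r)) = 4 * r ^ 2 * Real.pi := by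
    rw [Measure.real, EuclideanSpace.volume_closedBall_fin_two, ENNReal.toReal_mul,
      ENNReal.toReal_pow, ENNReal.toReal_ofReal (by positivity),
      ENNReal.toReal_ofReal Real.pi_pos.le]
    ring
  have hw : LocallyIntegrable (fun y => v y - v p) volume :=
    hv.sub (locallyIntegrable_const (v p))
  have hint : IntegrableOn (fun y => ‖v y - v p‖) (Metric.closedBall p (2 * r)) volume :=
    (hw.integrableOn_isCompact (isCompact_closedBall p (2 * r))).norm
  have e : smoothMean v r p - v p * kernelMass = ∫ y, (v y - v p) * avgKernel r p y := by
    simp only [sub_mul]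
    rw [integral_sub (integrable_mul_avgKernel hv hr p) ((integrable_avgKernel hr p).const_mul _),
      integral_const_mul, integral_avgKernel hr, smoothMean]
  rw [e, setAverage_eq, hvol, smul_eq_mul]
  calc |∫ y, (v y - v p) * avgKernel r p y|
      ≤ ∫ y, ‖(v y - v p) * avgKernel r p y‖ := by
        rw [← Real.norm_eq_abs]
        exact norm_integral_le_integral_norm _
    _ ≤ ∫ y : Plane,
          (Metric.closedBall p (2 * r)).indicator (fun y => 2 / r ^ 2 * ‖v y - v p‖) y := by
        refine integral_mono (integrable_mul_avgKernel hw hr p).norm ?_ fun y => ?_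
        · rw [integrable_indicator_iff measurableSet_closedBall]
          exact hint.const_mul _
        · by_cases hy : y ∈ Metric.closedBall p (2 * r)
          · rw [Set.indicator_of_mem hy, norm_mul, Real.norm_of_nonneg (avgKernel_nonneg r p y),
              mul_comm]
            exact mul_le_mul_of_nonneg_right (avgKernel_le r p y) (norm_nonneg _)
          · rw [Set.indicator_of_notMem hy, avgKernel_eq_zero hr, mul_zero, norm_zero]
            rw [Metric.mem_closedBall, dist_eq_norm, not_le] at hy
            nlinarith [norm_nonneg (y - p)]
    _ = 8 * Real.pi
          * ((4 * r ^ 2 * Real.pi)⁻¹ * ∫ y in Metric.closedBall p (2 * r), ‖v y - v p‖) := by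
        rw [integral_indicator measurableSet_closedBall, integral_const_mul]
        field_simp
        ring

/-- At almost every point the smooth means at small scales converge to the value of the function,
multiplied by the mass of the kernel. -/
lemma ae_tendsto_smoothMean {v : Plane → ℝ} (hv : LocallyIntegrable v volume) :
    ∀ᵐ p, Tendsto (fun n : ℕ => smoothMean v ((1 / 2 : ℝ) ^ n) p) atTop
      (nhds (v p * kernelMass)) := by
  filter_upwards [IsUnifLocDoublingMeasure.ae_tendsto_average_norm_sub volume hv 1] with p hp
  have hlim : Tendsto (fun n : ℕ => 2 * (1 / 2 : ℝ) ^ n) atTop (nhdsWithin 0 (Set.Ioi 0)) := by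
    refine tendsto_nhdsWithin_iff.2 ⟨?_, Eventually.of_forall fun n => by
      simp only [Set.mem_Ioi]; positivity⟩
    simpa using (tendsto_pow_atTop_nhds_zero_of_lt_one (by norm_num : (0 : ℝ) ≤ 1 / 2)
      (by norm_num)).const_mul 2
  have h := hp (fun _ => p) (fun n : ℕ => 2 * (1 / 2 : ℝ) ^ n) hlim
    (Eventually.of_forall fun n => Metric.mem_closedBall_self (by positivity))
  rw [tendsto_iff_norm_sub_tendsto_zero]
  refine squeeze_zero (fun _ => norm_nonneg _)
    (fun n => abs_smoothMean_sub_le hv (by positivity : (0 : ℝ) < (1 / 2) ^ n) p) ?_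
  simpa using h.const_mul (8 * Real.pi)

/-! ### Squares and their dyadic subdivision -/

lemma mem_square_iff {R : ℝ} {x y : Plane} : y ∈ square R x ↔ ∀ i, |y i - x i| ≤ R / 2 := by
  simp [square, abs_le]

lemma isClosed_square (R : ℝ) (x : Plane) : IsClosed (square R x) := by
  have : square R x = ⋂ i, {y : Plane | |y i - x i| ≤ R / 2} := by
    ext y; simp [mem_square_iff]
  rw [this]
  exact isClosed_iInter fun i => isClosed_le (by fun_prop) continuous_const

lemma measurableSet_square (R : ℝ) (x : Plane) : MeasurableSet (square R x) :=
  (isClosed_square R x).measurableSet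

lemma volume_square {R : ℝ} (hR : 0 ≤ R) (x : Plane) :
    volume (square R x) = ENNReal.ofReal (R ^ 2) := by
  have e : square R x = WithLp.ofLp ⁻¹'
      (Set.Icc (fun i => x i - R / 2) (fun i => x i + R / 2) : Set (Fin 2 → ℝ)) := by
    ext y
    simp only [square, Set.mem_ofPred_eq, Set.mem_Icc, Set.mem_preimage, Pi.le_def, ← forall_and]
    exact forall_congr' fun i => by constructor <;> rintro ⟨h1, h2⟩ <;> constructor <;> linarith
  rw [e, (PiLp.volume_preserving_ofLp (Fin 2)).measure_preimage measurableSet_Icc.nullMeasurableSet,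
    Real.volume_Icc_pi]
  simp only [Fin.prod_univ_two]
  rw [← ENNReal.ofReal_mul (by linarith)]
  congr 1
  ring

lemma volume_square_ne_top {R : ℝ} (hR : 0 ≤ R) (x : Plane) : volume (square R x) ≠ ⊤ := by
  rw [volume_square hR]; exact ENNReal.ofReal_ne_top

lemma volume_real_square {R : ℝ} (hR : 0 ≤ R) (x : Plane) :
    volume.real (square R x) = R ^ 2 := by
  rw [Measure.real, volume_square hR, ENNReal.toReal_ofReal (by positivity)]

lemma square_subset_square {R S : ℝ} {x y : Plane} (h : ∀ i, |x i - y i| ≤ (S - R) / 2) :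
    square R x ⊆ square S y := by
  intro z hz
  rw [mem_square_iff] at hz ⊢
  intro i
  have := abs_add_le (z i - x i) (x i - y i)
  rw [sub_add_sub_cancel] at this
  linarith [hz i, h i]

lemma norm_sq_sub_eq (x y : Plane) : ‖y - x‖ ^ 2 = (y 0 - x 0) ^ 2 + (y 1 - x 1) ^ 2 := by
  rw [EuclideanSpace.norm_sq_eq]
  simp [Fin.sum_univ_two]

lemma mem_square_of_norm_sq_le {R : ℝ} (hR : 0 ≤ R) {x y : Plane} (h : ‖y - x‖ ^ 2 ≤ (R / 2) ^ 2) :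
    y ∈ square R x := by
  rw [norm_sq_sub_eq] at h
  rw [mem_square_iff, Fin.forall_fin_two]
  constructor <;> refine abs_le_of_sq_le_sq ?_ (by linarith) <;> nlinarith

lemma norm_sq_le_of_mem_square {R : ℝ} {x y : Plane} (h : y ∈ square R x) :
    ‖y - x‖ ^ 2 ≤ R ^ 2 / 2 := by
  rw [mem_square_iff, Fin.forall_fin_two] at h
  rw [norm_sq_sub_eq]
  have h0 := sq_le_sq' (by linarith [(abs_le.1 h.1).1]) (abs_le.1 h.1).2
  have h1 := sq_le_sq' (by linarith [(abs_le.1 h.2).1]) (abs_le.1 h.2).2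
  nlinarith

lemma norm_sq_le_of_mem_square_of_mem_square {R : ℝ} {x y p : Plane} (hy : y ∈ square R x)
    (hp : p ∈ square R x) : ‖y - p‖ ^ 2 ≤ 2 * R ^ 2 := by
  rw [mem_square_iff, Fin.forall_fin_two] at hy hp
  simp only [abs_le] at hy hp
  rw [norm_sq_sub_eq]
  nlinarith

lemma isCompact_square (R : ℝ) (x : Plane) : IsCompact (square R x) := by
  refine (isCompact_closedBall x (|R|)).of_isClosed_subset (isClosed_square R x) fun y hy => ?_
  have := norm_sq_le_of_mem_square hy
  rw [Metric.mem_closedBall, dist_eq_norm]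
  refine le_of_sq_le_sq ?_ (abs_nonneg R)
  rw [sq_abs]
  nlinarith [sq_nonneg R]

/-- The displacement from the center of a square of side `2 * S` to the centers of its four
quarters, the quarters being labelled by the signs of the displacement. -/
noncomputable def quarterShift (S : ℝ) (b : Bool × Bool) : Plane :=
  !₂[cond b.1 (S / 2) (-(S / 2)), cond b.2 (S / 2) (-(S / 2))]

lemma exists_mem_quarter {S : ℝ} {x y : Plane} (hy : y ∈ square (2 * S) x) :
    ∃ b, y ∈ square S (x + quarterShift S b) := by
  rw [mem_square_iff, Fin.forall_fin_two] at hy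
  simp only [abs_le] at hy
  refine ⟨(decide (0 ≤ y 0 - x 0), decide (0 ≤ y 1 - x 1)), ?_⟩
  rw [mem_square_iff, Fin.forall_fin_two]
  constructor
  · by_cases h : 0 ≤ y 0 - x 0 <;> simp [quarterShift, h, abs_le] <;> constructor <;> linarith
  · by_cases h : 0 ≤ y 1 - x 1 <;> simp [quarterShift, h, abs_le] <;> constructor <;> linarith

/-- Subadditivity of the integral of a nonnegative function under division of a square into four
quarters. -/
lemma setIntegral_square_le_sum {h : Plane → ℝ} (h0 : ∀ᵐ y, 0 ≤ h y)
    (hi : LocallyIntegrable h volume) (S : ℝ) (x : Plane) :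
    ∫ y in square (2 * S) x, h y ≤ ∑ b, ∫ y in square S (x + quarterShift S b), h y := by
  have hint (R : ℝ) (z : Plane) : Integrable ((square R z).indicator h) volume :=
    (integrable_indicator_iff (measurableSet_square R z)).2
      (hi.integrableOn_isCompact (isCompact_square R z))
  simp_rw [← integral_indicator (measurableSet_square _ _)]
  rw [← integral_finsetSum _ fun b _ => hint _ _]
  refine integral_mono_ae (hint _ _) (integrable_finsetSum _ fun b _ => hint _ _) ?_
  filter_upwards [h0] with y hy
  have hnn (b : Bool × Bool) (_ : b ∈ Finset.univ) :
      0 ≤ (square S (x + quarterShift S b)).indicator h y :=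
    by
    by_cases hb : y ∈ square S (x + quarterShift S b) <;> simp [hb, hy]
  by_cases hm : y ∈ square (2 * S) x
  · obtain ⟨b, hb⟩ := exists_mem_quarter hm
    rw [Set.indicator_of_mem hm]
    calc h y = (square S (x + quarterShift S b)).indicator h y := (Set.indicator_of_mem hb h).symm
      _ ≤ _ := Finset.single_le_sum hnn (Finset.mem_univ b)
  · rw [Set.indicator_of_notMem hm]
    exact Finset.sum_nonneg hnn

/-! ### Area and density of bounded solutions -/

/-- Entire solutions bounded above by `M`, with curvature between `lam` and `Lam`. -/
structure IsBoundedSolution (M lam Lam : ℝ) (K u : Plane → ℝ) : Prop where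
  pos : 0 < lam
  le_curvature : ∀ᵐ x, lam ≤ K x
  curvature_le : ∀ᵐ x, K x ≤ Lam
  le_bound : ∀ᵐ x, u x ≤ M
  solution : IsEntireSolution K u

/-- The area `∫ e^{2u}` of the square of side `R` and center `x`. -/
noncomputable def area (u : Plane → ℝ) (R : ℝ) (x : Plane) : ℝ :=
  ∫ y in square R x, Real.exp (2 * u y)

/-- The largest density of the dyadic squares of side `2 ^ k`, as a real number. -/
noncomputable def dyadicDensity (u : Plane → ℝ) (k : ℕ) : ℝ :=
  ⨆ x, area u (2 ^ k) x / 4 ^ k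

lemma area_nonneg (u : Plane → ℝ) (R : ℝ) (x : Plane) : 0 ≤ area u R x :=
  integral_nonneg fun _ => (Real.exp_pos _).le

namespace IsBoundedSolution

variable {M lam Lam : ℝ} {K u : Plane → ℝ}

lemma curvature_nonneg (H : IsBoundedSolution M lam Lam K u) : 0 ≤ Lam := by
  obtain ⟨x, h1, h2⟩ := (H.le_curvature.and H.curvature_le).exists
  linarith [H.pos]

lemma locallyIntegrable_exp (H : IsBoundedSolution M lam Lam K u) :
    LocallyIntegrable (fun y => Real.exp (2 * u y)) volume := by
  refine (locallyIntegrable_const (Real.exp (2 * M))).mono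
    (Real.continuous_exp.comp_aestronglyMeasurable
      (H.solution.locallyIntegrable.aestronglyMeasurable.const_mul 2)) ?_
  filter_upwards [H.le_bound] with y hy
  rw [Real.norm_of_nonneg (Real.exp_pos _).le, Real.norm_of_nonneg (Real.exp_pos _).le]
  gcongr

lemma integrableOn_exp (H : IsBoundedSolution M lam Lam K u) (R : ℝ) (x : Plane) :
    IntegrableOn (fun y => Real.exp (2 * u y)) (square R x) volume :=
  H.locallyIntegrable_exp.integrableOn_isCompact (isCompact_square R x)

lemma area_le (H : IsBoundedSolution M lam Lam K u) {R : ℝ} (hR : 0 ≤ R) (x : Plane) :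
    area u R x ≤ Real.exp (2 * M) * R ^ 2 := by
  have h : area u R x ≤ ∫ _ in square R x, Real.exp (2 * M) := by
    refine setIntegral_mono_ae (H.integrableOn_exp R x)
      (integrableOn_const (volume_square_ne_top hR x)) ?_
    filter_upwards [H.le_bound] with y hy
    gcongr
  rwa [setIntegral_const, volume_real_square hR, smul_eq_mul, mul_comm] at h

lemma area_mono (H : IsBoundedSolution M lam Lam K u) {R S : ℝ} {x y : Plane}
    (h : square R x ⊆ square S y) : area u R x ≤ area u S y :=
  setIntegral_mono_set (H.integrableOn_exp S y) (ae_of_all _ fun _ => (Real.exp_pos _).le)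
    h.eventuallyLE

lemma area_two_mul_le (H : IsBoundedSolution M lam Lam K u) (S : ℝ) (x : Plane) :
    area u (2 * S) x ≤ ∑ b, area u S (x + quarterShift S b) :=
  setIntegral_square_le_sum (ae_of_all _ fun _ => (Real.exp_pos _).le) H.locallyIntegrable_exp S x

lemma area_div_le (H : IsBoundedSolution M lam Lam K u) (k : ℕ) (x : Plane) :
    area u (2 ^ k) x / 4 ^ k ≤ Real.exp (2 * M) := by
  rw [div_le_iff₀ (by positivity)]
  refine (H.area_le (by positivity) x).trans_eq ?_
  rw [← pow_mul, mul_comm k 2, pow_mul]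
  norm_num

lemma bddAbove_area_div (H : IsBoundedSolution M lam Lam K u) (k : ℕ) :
    BddAbove (Set.range fun x => area u (2 ^ k) x / 4 ^ k) :=
  ⟨_, by rintro _ ⟨x, rfl⟩; exact H.area_div_le k x⟩

lemma dyadicDensity_nonneg (u : Plane → ℝ) (k : ℕ) : 0 ≤ dyadicDensity u k :=
  Real.iSup_nonneg fun x => div_nonneg (area_nonneg u _ x) (by positivity)

lemma dyadicDensity_le (H : IsBoundedSolution M lam Lam K u) (k : ℕ) :
    dyadicDensity u k ≤ Real.exp (2 * M) :=
  ciSup_le (H.area_div_le k)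

lemma area_le_dyadicDensity (H : IsBoundedSolution M lam Lam K u) (k : ℕ) (x : Plane) :
    area u (2 ^ k) x ≤ dyadicDensity u k * 4 ^ k := by
  rw [← div_le_iff₀ (by positivity)]
  exact le_ciSup (H.bddAbove_area_div k) x

lemma dyadicDensity_antitone (H : IsBoundedSolution M lam Lam K u) :
    Antitone (dyadicDensity u) := by
  refine antitone_nat_of_succ_le fun k => ciSup_le fun x => ?_
  rw [div_le_iff₀ (by positivity), pow_succ' (2 : ℝ) k]
  refine (H.area_two_mul_le (2 ^ k) x).trans ?_
  refine (Finset.sum_le_sum fun b _ => H.area_le_dyadicDensity k _).trans_eq ?_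
  simp [pow_succ]
  ring

/-! ### Upper and lower bounds for smooth means -/

lemma integral_potKernel_le (H : IsBoundedSolution M lam Lam K u) {r : ℝ} (hr : 0 < r)
    (p : Plane) :
    ∫ y, K y * Real.exp (2 * u y) * potKernel r p y ≤ Lam * area u (8 * r) p := by
  rw [area, ← integral_const_mul, ← integral_indicator (measurableSet_square _ _)]
  refine integral_mono_ae (integrable_mul_potKernel H.solution.locallyIntegrable_rhs hr p)
    ((integrable_indicator_iff (measurableSet_square _ _)).2
      ((H.integrableOn_exp _ p).const_mul _)) ?_
  filter_upwards [H.curvature_le] with y hK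
  by_cases hy : y ∈ square (8 * r) p
  · rw [Set.indicator_of_mem hy]
    calc K y * Real.exp (2 * u y) * potKernel r p y
        ≤ Lam * Real.exp (2 * u y) * potKernel r p y := by
          have := potKernel_nonneg r p y
          gcongr
      _ ≤ Lam * Real.exp (2 * u y) :=
          mul_le_of_le_one_right (mul_nonneg H.curvature_nonneg (Real.exp_pos _).le)
            (potKernel_le_one r p y)
  · rw [Set.indicator_of_notMem hy, potKernel_eq_zero hr, mul_zero]
    by_contra! hlt
    exact hy (mem_square_of_norm_sq_le (by positivity) (by nlinarith))

lemma le_integral_potKernel (H : IsBoundedSolution M lam Lam K u) {r : ℝ} (hr : 0 < r)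
    (p : Plane) :
    lam / 4 * area u r p ≤ ∫ y, K y * Real.exp (2 * u y) * potKernel r p y := by
  rw [area, ← integral_const_mul, ← integral_indicator (measurableSet_square _ _)]
  refine integral_mono_ae ((integrable_indicator_iff (measurableSet_square _ _)).2
      ((H.integrableOn_exp _ p).const_mul _))
    (integrable_mul_potKernel H.solution.locallyIntegrable_rhs hr p) ?_
  filter_upwards [H.le_curvature] with y hK
  have hpos := H.pos
  have hk := potKernel_nonneg r p y
  by_cases hy : y ∈ square r p
  · rw [Set.indicator_of_mem hy]
    have h := le_potKernel (r := r) ((norm_sq_le_of_mem_square hy).trans (by nlinarith))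
    calc lam / 4 * Real.exp (2 * u y) = lam * Real.exp (2 * u y) * (1 / 4) := by ring
      _ ≤ K y * Real.exp (2 * u y) * potKernel r p y := by
          have := hpos.le.trans hK
          gcongr
  · rw [Set.indicator_of_notMem hy]
    have := hpos.le.trans hK
    positivity

lemma smoothMean_nonneg (H : IsBoundedSolution M lam Lam K u) (r : ℝ) (p : Plane) :
    0 ≤ smoothMean (fun y => M - u y) r p := by
  refine integral_nonneg_of_ae ?_
  filter_upwards [H.le_bound] with y hy
  exact mul_nonneg (sub_nonneg.2 hy) (avgKernel_nonneg r p y)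

lemma locallyIntegrable_sub (H : IsBoundedSolution M lam Lam K u) :
    LocallyIntegrable (fun y => M - u y) volume :=
  (locallyIntegrable_const M).sub H.solution.locallyIntegrable

/-- At small scales, the bound `e^{2u} ≤ e^{2M}` controls the growth of the smooth means. -/
lemma smoothMean_one_le_smoothMean_half_pow (H : IsBoundedSolution M lam Lam K u) (p : Plane)
    (n : ℕ) :
    smoothMean (fun y => M - u y) 1 p ≤ smoothMean (fun y => M - u y) ((1 / 2 : ℝ) ^ n) p
      + 64 / 3 * Lam * Real.exp (2 * M) * (1 - (1 / 4) ^ n) := by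
  induction n with
  | zero => simp
  | succ n ih =>
    have hr : (0 : ℝ) < (1 / 2) ^ (n + 1) := by positivity
    have h1 := smoothMean_two_mul H.solution M hr p
    rw [show 2 * (1 / 2 : ℝ) ^ (n + 1) = (1 / 2) ^ n by rw [pow_succ]; ring] at h1
    have h2 := (H.integral_potKernel_le hr p).trans
      (mul_le_mul_of_nonneg_left (H.area_le (by positivity) p) H.curvature_nonneg)
    rw [show (8 * (1 / 2 : ℝ) ^ (n + 1)) ^ 2 = 16 * (1 / 4) ^ n by
      rw [mul_pow, ← pow_mul, mul_comm (n + 1) 2, pow_mul, pow_succ]; norm_num; ring] at h2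
    rw [pow_succ (1 / 4 : ℝ)]
    nlinarith

/-- At almost every point the smooth mean at scale `2 ^ m` is bounded by the value at the point
and by the densities of the squares at all the scales below. -/
lemma ae_smoothMean_le (H : IsBoundedSolution M lam Lam K u) :
    ∀ᵐ p, ∀ m : ℕ, smoothMean (fun y => M - u y) (2 ^ m) p ≤ (M - u p) * kernelMass
      + 64 / 3 * Lam * Real.exp (2 * M)
      + 64 * Lam * ∑ j ∈ Finset.range m, 4 ^ j * dyadicDensity u j := by
  filter_upwards [ae_tendsto_smoothMean H.locallyIntegrable_sub] with p hp m
  induction m with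
  | zero =>
    have hlim := hp.add_const (64 / 3 * Lam * Real.exp (2 * M))
    have : smoothMean (fun y => M - u y) 1 p
        ≤ (M - u p) * kernelMass + 64 / 3 * Lam * Real.exp (2 * M) := by
      refine ge_of_tendsto' hlim fun n => ?_
      refine (H.smoothMean_one_le_smoothMean_half_pow p n).trans ?_
      refine add_le_add_right (mul_le_of_le_one_right ?_ ?_) _
      · have := H.curvature_nonneg; positivity
      · have : (0 : ℝ) ≤ (1 / 4) ^ n := by positivity
        linarith
    simpa using this
  | succ m ih =>
    have hr : (0 : ℝ) < 2 ^ m := by positivity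
    have h1 := smoothMean_two_mul H.solution M hr p
    have h2 : area u (8 * 2 ^ m) p ≤ 64 * (4 ^ m * dyadicDensity u m) := by
      have e := H.area_le_dyadicDensity (m + 3) p
      have e' := H.dyadicDensity_antitone (show m ≤ m + 3 by omega)
      rw [pow_add, pow_add] at e
      norm_num at e
      rw [mul_comm (8 : ℝ)]
      refine e.trans ?_
      have := mul_le_mul_of_nonneg_right e' (show (0 : ℝ) ≤ 4 ^ m * 64 by positivity)
      linarith
    have h3 := (H.integral_potKernel_le hr p).trans
      (mul_le_mul_of_nonneg_left h2 H.curvature_nonneg)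
    rw [pow_succ' (2 : ℝ) m, h1, Finset.sum_range_succ]
    linarith

lemma ae_sub_nonneg (H : IsBoundedSolution M lam Lam K u) : ∀ᵐ y, 0 ≤ M - u y := by
  filter_upwards [H.le_bound] with y hy using sub_nonneg.2 hy

lemma integrable_indicator_sub (H : IsBoundedSolution M lam Lam K u) (R : ℝ) (x : Plane) :
    Integrable ((square R x).indicator fun y => M - u y) volume :=
  (integrable_indicator_iff (measurableSet_square _ _)).2
    (H.locallyIntegrable_sub.integrableOn_isCompact (isCompact_square _ _))

lemma smoothMean_le_setIntegral (H : IsBoundedSolution M lam Lam K u) {r T : ℝ} (hr : 0 < r)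
    {p x : Plane} (hsub : square (4 * r) p ⊆ square T x) :
    smoothMean (fun y => M - u y) r p ≤ 2 / r ^ 2 * ∫ y in square T x, (M - u y) := by
  rw [← integral_indicator (measurableSet_square _ _), ← integral_const_mul]
  refine integral_mono_ae (integrable_mul_avgKernel H.locallyIntegrable_sub hr p)
    ((H.integrable_indicator_sub T x).const_mul _) ?_
  filter_upwards [H.ae_sub_nonneg] with y hv
  by_cases hy : y ∈ square T x
  · simp only [Set.indicator_of_mem hy]
    rw [mul_comm]
    exact mul_le_mul_of_nonneg_right (avgKernel_le r p y) hv
  · simp only [Set.indicator_of_notMem hy, mul_zero]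
    rw [avgKernel_eq_zero hr, mul_zero]
    by_contra! hlt
    exact hy (hsub (mem_square_of_norm_sq_le (by positivity) (by nlinarith)))

lemma setIntegral_le_smoothMean (H : IsBoundedSolution M lam Lam K u) {R : ℝ} (hR : 0 < R)
    {p x : Plane} (hp : p ∈ square R x) :
    ∫ y in square R x, (M - u y) ≤ 4 * R ^ 2 * smoothMean (fun y => M - u y) (2 * R) p := by
  rw [← integral_indicator (measurableSet_square _ _), smoothMean, ← integral_const_mul]
  refine integral_mono_ae (H.integrable_indicator_sub R x)
    ((integrable_mul_avgKernel H.locallyIntegrable_sub (by positivity) p).const_mul _) ?_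
  filter_upwards [H.ae_sub_nonneg] with y hv
  by_cases hy : y ∈ square R x
  · simp only [Set.indicator_of_mem hy]
    have h := le_avgKernel (r := 2 * R) (by positivity)
      ((norm_sq_le_of_mem_square_of_mem_square hy hp).trans (by nlinarith))
    have h' := mul_le_mul_of_nonneg_left (mul_le_mul_of_nonneg_left h hv)
      (show 0 ≤ 4 * R ^ 2 by positivity)
    refine le_trans (le_of_eq ?_) h'
    field_simp
    norm_num
  · simp only [Set.indicator_of_notMem hy]
    have := avgKernel_nonneg (2 * R) p y
    positivity

/-- A square of density at least `d / 2` contains a point, in any given conull set, at which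
`e^{2u}` is at least `d / 4`. -/
lemma exists_mem_square_le_exp (H : IsBoundedSolution M lam Lam K u) {R d : ℝ} (hR : 0 < R)
    (hd : 0 < d) {x : Plane} (h : d / 2 * R ^ 2 ≤ area u R x) {P : Plane → Prop}
    (hP : ∀ᵐ p, P p) : ∃ p ∈ square R x, P p ∧ d / 4 ≤ Real.exp (2 * u p) := by
  by_contra! hcon
  have hle : area u R x ≤ ∫ _ in square R x, d / 4 := by
    refine setIntegral_mono_on_ae (H.integrableOn_exp R x)
      (integrableOn_const (volume_square_ne_top hR.le x)) (measurableSet_square _ _) ?_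
    filter_upwards [hP] with y hy hmem
    exact (hcon y hmem hy).le
  rw [setIntegral_const, volume_real_square hR.le, smul_eq_mul] at hle
  have := mul_pos hd (pow_pos hR 2)
  linarith

/-! ### Decay of the dyadic densities -/

/-- The constant in the bound for the integral of `M - u` over a dense dyadic square. -/
noncomputable def heightConst (M Lam : ℝ) : ℝ :=
  4 * ((|M| + 2) * kernelMass + 64 / 3 * Lam * Real.exp (2 * M) + 128 * Lam)

/-- If the density at scale `2 ^ k` is not too small, neither absolutely nor compared to the
densities at smaller scales, then on each square of side `2 ^ k` which is at least half as dense as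
possible the mean of `M - u` is controlled by `4 ^ k` times the density. -/
lemma setIntegral_le_of_dense (H : IsBoundedSolution M lam Lam K u) {k : ℕ}
    (ha : 1 ≤ 2 ^ k * dyadicDensity u k)
    (hb : ∀ j < k, 2 ^ j * dyadicDensity u j ≤ 2 ^ k * dyadicDensity u k) {x : Plane}
    (hx : dyadicDensity u k / 2 * 4 ^ k ≤ area u (2 ^ k) x) :
    ∫ y in square (2 ^ k) x, (M - u y)
      ≤ 4 ^ k * (heightConst M Lam * (4 ^ k * dyadicDensity u k)) := by
  set d := dyadicDensity u k with hd
  have h2 : (1 : ℝ) ≤ 2 ^ k := one_le_pow₀ (by norm_num)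
  have h4 : (4 : ℝ) ^ k = 2 ^ k * 2 ^ k := by rw [← mul_pow]; norm_num
  have hdpos : 0 < d := by
    by_contra! hneg
    nlinarith
  have h4d : 2 ^ k ≤ 4 ^ k * d := by rw [h4]; nlinarith
  have hLam := H.curvature_nonneg
  obtain ⟨p, hp, hmean, hexp⟩ := H.exists_mem_square_le_exp (by positivity : (0 : ℝ) < 2 ^ k) hdpos
    (by rwa [← pow_mul, mul_comm k 2, pow_mul, show (2 : ℝ) ^ 2 = 4 by norm_num])
    H.ae_smoothMean_le
  -- The logarithm of `4 / d` is only needed up to the crude bound `t + 1 ≤ exp t`.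
  have hu : -u p ≤ 2 * 2 ^ k := by
    have e1 := Real.add_one_le_exp (-(2 * u p))
    have e2 : Real.exp (-(2 * u p)) * Real.exp (2 * u p) = 1 := by
      rw [← Real.exp_add, neg_add_cancel, Real.exp_zero]
    have e3 : Real.exp (-(2 * u p)) ≤ 4 * 2 ^ k := by
      by_contra! hlt
      have := mul_le_mul hlt.le hexp (by positivity) (Real.exp_pos _).le
      have := mul_lt_mul hlt hexp (by positivity) (Real.exp_pos _).le
      nlinarith
    linarith
  have hMu : M - u p ≤ (|M| + 2) * (4 ^ k * d) := by
    have := le_abs_self M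
    have := mul_le_mul_of_nonneg_left (h2.trans h4d) (abs_nonneg M)
    nlinarith
  have hsum : ∑ j ∈ Finset.range (k + 1), 4 ^ j * dyadicDensity u j ≤ 2 * (4 ^ k * d) := by
    calc ∑ j ∈ Finset.range (k + 1), 4 ^ j * dyadicDensity u j
        ≤ ∑ j ∈ Finset.range (k + 1), 2 ^ j * (2 ^ k * d) := by
          refine Finset.sum_le_sum fun j hj => ?_
          have hj' : 2 ^ j * dyadicDensity u j ≤ 2 ^ k * d := by
            rcases (Nat.lt_succ_iff.1 (Finset.mem_range.1 hj)).lt_or_eq with h | h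
            · exact hb j h
            · rw [h]
          rw [show (4 : ℝ) ^ j = 2 ^ j * 2 ^ j by rw [← mul_pow]; norm_num, mul_assoc]
          gcongr
      _ = (2 ^ (k + 1) - 1) * (2 ^ k * d) := by
          rw [← Finset.sum_mul, geom_sum_eq (by norm_num)]
          norm_num
      _ ≤ 2 * (4 ^ k * d) := by
          rw [h4, pow_succ]
          have : 0 ≤ 2 ^ k * d := by positivity
          nlinarith
  have hbound : smoothMean (fun y => M - u y) (2 * 2 ^ k) p
      ≤ heightConst M Lam / 4 * (4 ^ k * d) := by
    have h := hmean (k + 1)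
    rw [pow_succ'] at h
    have i1 := mul_le_mul_of_nonneg_right hMu kernelMass_nonneg
    have i2 := mul_le_mul_of_nonneg_left hsum (show 0 ≤ 64 * Lam by positivity)
    have i3 := mul_le_mul_of_nonneg_left (h2.trans h4d)
      (show 0 ≤ 64 / 3 * Lam * Real.exp (2 * M) by positivity)
    rw [heightConst]
    linarith
  refine (H.setIntegral_le_smoothMean (by positivity) hp).trans ?_
  refine (mul_le_mul_of_nonneg_left hbound (by positivity)).trans_eq ?_
  rw [h4]
  ring

/-- If no square of side `S` has area more than `D`, each quarter of a square of side `2 * S`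
misses the value `D` by at most the amount by which the whole square misses `4 * D`. -/
lemma le_area_quarter (H : IsBoundedSolution M lam Lam K u) {S D E : ℝ}
    (hD : ∀ z, area u S z ≤ D) {x : Plane} (h : 4 * D - E ≤ area u (2 * S) x) (b : Bool × Bool) :
    D - E ≤ area u S (x + quarterShift S b) := by
  have h1 := h.trans (H.area_two_mul_le S x)
  rw [← Finset.add_sum_erase _ _ (Finset.mem_univ b)] at h1
  have h2 : ∑ c ∈ Finset.univ.erase b, area u S (x + quarterShift S c) ≤ 3 * D := by
    refine (Finset.sum_le_card_nsmul _ _ D fun c _ => hD _).trans_eq ?_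
    simp [Finset.card_erase_of_mem]
  linarith

lemma area_le_dyadicDensity_mul (H : IsBoundedSolution M lam Lam K u) (k j : ℕ) (x : Plane) :
    area u (2 ^ (k + j)) x ≤ dyadicDensity u k * 4 ^ (k + j) :=
  (H.area_le_dyadicDensity (k + j) x).trans
    (mul_le_mul_of_nonneg_right (H.dyadicDensity_antitone (by omega)) (by positivity))

/-- A quarter of a nearly extremal dyadic square is nearly extremal: the defect of area, compared
to a square of the largest density, does not increase. -/
lemma le_area_dyadic_quarter (H : IsBoundedSolution M lam Lam K u) {k j : ℕ} {E : ℝ} {x : Plane}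
    (h : dyadicDensity u k * 4 ^ (k + (j + 1)) - E ≤ area u (2 ^ (k + (j + 1))) x)
    (b : Bool × Bool) :
    dyadicDensity u k * 4 ^ (k + j) - E
      ≤ area u (2 ^ (k + j)) (x + quarterShift (2 ^ (k + j)) b) := by
  refine H.le_area_quarter (H.area_le_dyadicDensity_mul k j) ?_ b
  rw [← pow_succ']
  refine le_trans (le_of_eq ?_) h
  rw [← add_assoc, pow_succ]
  ring

/-- In a nearly extremal square all the dyadic subsquares of side `2 ^ k` are dense, so that the
bounds for the integral of `M - u` add up. -/
lemma setIntegral_le_of_nearly_extremal (H : IsBoundedSolution M lam Lam K u) {k : ℕ} {B : ℝ}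
    (hB : ∀ x, dyadicDensity u k / 2 * 4 ^ k ≤ area u (2 ^ k) x →
      ∫ y in square (2 ^ k) x, (M - u y) ≤ B) (j : ℕ) :
    ∀ x, dyadicDensity u k * 4 ^ (k + j) - dyadicDensity u k / 2 * 4 ^ k
        ≤ area u (2 ^ (k + j)) x →
      ∫ y in square (2 ^ (k + j)) x, (M - u y) ≤ 4 ^ j * B := by
  induction j with
  | zero =>
    intro x hx
    simpa using hB x (by rw [add_zero] at hx; linarith)
  | succ j ih =>
    intro x hx
    rw [← add_assoc, pow_succ' (2 : ℝ)]
    refine (setIntegral_square_le_sum H.ae_sub_nonneg H.locallyIntegrable_sub _ x).trans ?_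
    refine (Finset.sum_le_sum fun b _ => ih _ (H.le_area_dyadic_quarter hx b)).trans_eq ?_
    simp [pow_succ]
    ring

/-- In a nearly extremal square the smooth means of `M - u` grow at least quadratically with the
scale. This is tested around a center chosen so that all the squares in question lie inside the
given one. -/
lemma le_setIntegral_of_nearly_extremal (H : IsBoundedSolution M lam Lam K u) {k l : ℕ}
    {x : Plane}
    (hx : dyadicDensity u k * 4 ^ (k + (l + 4)) - dyadicDensity u k / 2 * 4 ^ k
      ≤ area u (2 ^ (k + (l + 4))) x) :
    lam / 4 * (dyadicDensity u k * 4 ^ (k + l)) * 4 ^ (k + l)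
      ≤ ∫ y in square (2 ^ (k + (l + 4))) x, (M - u y) := by
  have h1 := H.le_area_dyadic_quarter (H.le_area_dyadic_quarter (H.le_area_dyadic_quarter
    (H.le_area_dyadic_quarter hx (true, true)) (false, false)) (false, false)) (false, false)
  -- With `S` the side of the square, `c` is `x` shifted by `S / 32` in both coordinates.
  set c := x + quarterShift (2 ^ (k + (l + 3))) (true, true)
    + quarterShift (2 ^ (k + (l + 2))) (false, false)
    + quarterShift (2 ^ (k + (l + 1))) (false, false)
    + quarterShift (2 ^ (k + l)) (false, false) with hc
  set ρ : ℝ := 2 ^ (k + l) with hρ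
  have hρ0 : 0 < ρ := by positivity
  have hρ4 : (4 : ℝ) ^ (k + l) = ρ ^ 2 := by
    rw [hρ, ← pow_mul, mul_comm (k + l) 2, pow_mul]; norm_num
  have hpow (i : ℕ) : (2 : ℝ) ^ (k + (l + i)) = 2 ^ i * ρ := by
    rw [hρ, ← add_assoc, pow_add]; ring
  have hsub : square (4 * (2 * ρ)) c ⊆ square (2 ^ (k + (l + 4))) x := by
    refine square_subset_square (Fin.forall_fin_two.2 ?_)
    rw [hc]
    simp only [hpow]
    constructor <;> simp [quarterShift, abs_le] <;> constructor <;> linarith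
  have h2 := H.smoothMean_le_setIntegral (by positivity) hsub
  have h3 := smoothMean_two_mul H.solution M hρ0 c
  have h4 := H.le_integral_potKernel hρ0 c
  have h5 := H.smoothMean_nonneg ρ c
  have h6 : dyadicDensity u k / 2 * 4 ^ k ≤ dyadicDensity u k / 2 * 4 ^ (k + l) := by
    have := dyadicDensity_nonneg u k
    exact mul_le_mul_of_nonneg_left (pow_le_pow_right₀ (by norm_num) (by omega)) (by positivity)
  have h7 : lam / 4 * (dyadicDensity u k / 2 * ρ ^ 2)
      ≤ 2 / (2 * ρ) ^ 2 * ∫ y in square (2 ^ (k + (l + 4))) x, (M - u y) := by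
    have : dyadicDensity u k / 2 * ρ ^ 2 ≤ area u ρ c := by rw [hρ4] at h1 h6; linarith
    have := mul_le_mul_of_nonneg_left this (show 0 ≤ lam / 4 by linarith [H.pos])
    linarith
  rw [hρ4]
  have h8 := mul_le_mul_of_nonneg_left h7 (show 0 ≤ 2 * ρ ^ 2 by positivity)
  refine le_trans (le_of_eq ?_) (h8.trans_eq ?_)
  · ring
  · field_simp

/-- Either the density at scale `2 ^ k` is small, absolutely or compared to the density at some
smaller scale, or it drops by a fixed factor after a fixed number of doublings. -/
lemma dyadicDensity_trichotomy (H : IsBoundedSolution M lam Lam K u) {l : ℕ}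
    (hl : 1024 * heightConst M Lam < lam * 4 ^ l) (k : ℕ) :
    2 ^ k * dyadicDensity u k ≤ 1 ∨
    (∃ j < k, 2 ^ k * dyadicDensity u k ≤ 2 ^ j * dyadicDensity u j) ∨
    dyadicDensity u (k + (l + 4)) ≤ (1 - 1 / 2 * (1 / 4) ^ (l + 4)) * dyadicDensity u k := by
  by_contra! hcon
  obtain ⟨ha, hb, hc⟩ := hcon
  set d := dyadicDensity u k with hd
  have hdpos : 0 < d := by
    by_contra! hneg
    nlinarith [pow_pos (two_pos : (0 : ℝ) < 2) k]
  -- Otherwise some square of side `2 ^ (k + l + 4)` is nearly extremal; its defect of area is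
  -- at most half of the largest area at scale `2 ^ k`.
  obtain ⟨x, hx⟩ : ∃ x, d * 4 ^ (k + (l + 4)) - d / 2 * 4 ^ k ≤ area u (2 ^ (k + (l + 4))) x := by
    by_contra! hlt
    refine hc.not_ge (ciSup_le fun x => ?_)
    rw [div_le_iff₀ (by positivity)]
    refine (hlt x).le.trans_eq ?_
    rw [pow_add (4 : ℝ) k, one_div_pow]
    field_simp
  have h1 := H.setIntegral_le_of_nearly_extremal
    (fun x => H.setIntegral_le_of_dense ha.le (fun j hj => (hb j hj).le)) (l + 4) x hx
  have h2 := (H.le_setIntegral_of_nearly_extremal hx).trans h1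
  rw [← hd, pow_add, pow_add] at h2
  have h3 : 0 < (4 : ℝ) ^ k * 4 ^ k * 4 ^ l * d := by positivity
  have h4 : (4 ^ k * 4 ^ k * 4 ^ l * d) * (lam * 4 ^ l)
      ≤ (4 ^ k * 4 ^ k * 4 ^ l * d) * (1024 * heightConst M Lam) := by
    norm_num at h2
    linarith
  exact absurd (le_of_mul_le_mul_left h4 h3) hl.not_ge

end IsBoundedSolution

/-- A nonincreasing sequence which at each index is either small, or small compared to an earlier
term, or drops by a fixed factor after `n` steps, decays geometrically. -/
lemma exists_geometric_bound (n : ℕ) {q : ℝ} (hq : 1 / 2 ≤ q) (hq1 : q < 1) (D : ℝ) :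
    ∃ θ C : ℝ, 0 < θ ∧ θ < 1 ∧ 0 < C ∧ ∀ d : ℕ → ℝ, Antitone d → (∀ k, d k ≤ D) →
      (∀ k, 2 ^ k * d k ≤ 1 ∨ (∃ j < k, 2 ^ k * d k ≤ 2 ^ j * d j) ∨ d (k + n) ≤ q * d k) →
      ∀ k, d k ≤ C * θ ^ k := by
  have hq0 : 0 < q := by linarith
  -- `θ` is chosen so that `n + 1` steps of the decay rate amount to the factor `q`.
  obtain ⟨θ, h0, h1, hθ⟩ : ∃ θ : ℝ, 0 < θ ∧ θ < 1 ∧ θ ^ (n + 1) = q :=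
    ⟨q ^ (((n + 1 : ℕ) : ℝ)⁻¹), Real.rpow_pos_of_pos hq0 _,
      Real.rpow_lt_one hq0.le hq1 (by positivity), Real.rpow_inv_natCast_pow hq0.le (by omega)⟩
  have hθn : q ≤ θ ^ n := hθ ▸ pow_le_pow_of_le_one h0.le h1.le (by omega)
  have hθ1 : 1 / 2 ≤ θ := hq.trans (hθ ▸ pow_le_of_le_one h0.le h1.le (by omega))
  have hθn0 : 0 < θ ^ n := by positivity
  refine ⟨θ, max D 1 / θ ^ n, h0, h1, by positivity, fun d hanti hD htri k => ?_⟩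
  have hC : max D 1 / θ ^ n * θ ^ n = max D 1 := div_mul_cancel₀ _ hθn0.ne'
  have hC0 : 0 < max D 1 / θ ^ n := by positivity
  set C := max D 1 / θ ^ n
  induction k using Nat.strong_induction_on with
  | _ k ih =>
    rcases lt_or_ge k n with hk | hk
    · calc d k ≤ max D 1 := (hD k).trans (le_max_left _ _)
        _ = C * θ ^ n := hC.symm
        _ ≤ C * θ ^ k := mul_le_mul_of_nonneg_left (pow_le_pow_of_le_one h0.le h1.le hk.le) hC0.le
    · obtain ⟨m, rfl⟩ := Nat.exists_eq_add_of_le' hk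
      have hle : d (m + n) ≤ d m := hanti (by omega)
      have hpow : (1 / 2 : ℝ) ^ m ≤ θ ^ m := pow_le_pow_left₀ (by norm_num) hθ1 m
      have h22 (i : ℕ) : (1 / 2 : ℝ) ^ i * 2 ^ i = 1 := by rw [← mul_pow]; norm_num
      rcases htri m with h | ⟨j, hj, h⟩ | h
      · have hm : d m ≤ (1 / 2) ^ m := by
          have := mul_le_mul_of_nonneg_left h (show (0 : ℝ) ≤ (1 / 2) ^ m by positivity)
          rwa [← mul_assoc, h22, one_mul, mul_one] at this
        calc d (m + n) ≤ 1 * θ ^ m := by linarith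
          _ ≤ (C * θ ^ n) * θ ^ m := by
            rw [hC]
            exact mul_le_mul_of_nonneg_right (le_max_right _ _) (by positivity)
          _ = C * θ ^ (m + n) := by ring
      · obtain ⟨i, rfl⟩ := Nat.exists_eq_add_of_lt hj
        have hdj := ih j (by omega)
        have hm : d (j + i + 1) ≤ (1 / 2) ^ (i + 1) * d j := by
          have h' := mul_le_mul_of_nonneg_left h
            (show (0 : ℝ) ≤ (1 / 2) ^ (j + i + 1) by positivity)
          rw [← mul_assoc, h22, one_mul] at h'
          refine h'.trans_eq ?_
          rw [add_assoc, pow_add, show (1 / 2 : ℝ) ^ j * (1 / 2) ^ (i + 1) * (2 ^ j * d j)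
            = (1 / 2) ^ j * 2 ^ j * ((1 / 2) ^ (i + 1) * d j) by ring, h22, one_mul]
        have hi : (1 / 2 : ℝ) ^ i ≤ θ ^ i := pow_le_pow_left₀ (by norm_num) hθ1 i
        have hhalf : (1 / 2 : ℝ) ≤ θ ^ (n + 1) := hq.trans_eq hθ.symm
        calc d (j + i + 1 + n) ≤ (1 / 2) ^ (i + 1) * d j := hle.trans hm
          _ ≤ (1 / 2) ^ (i + 1) * (C * θ ^ j) := by gcongr
          _ = (1 / 2) ^ i * (1 / 2) * (C * θ ^ j) := by rw [pow_succ]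
          _ ≤ θ ^ i * θ ^ (n + 1) * (C * θ ^ j) := by gcongr
          _ = C * θ ^ (j + i + 1 + n) := by ring
      · rcases Nat.eq_zero_or_pos n with rfl | hn
        · simp only [zero_add, pow_one] at hθ
          simp only [add_zero] at h ⊢
          have : d m ≤ 0 := by nlinarith
          exact this.trans (by positivity)
        · calc d (m + n) ≤ q * d m := h
            _ ≤ q * (C * θ ^ m) := by gcongr; exact ih m (by omega)
            _ ≤ θ ^ n * (C * θ ^ m) := by gcongr
            _ = C * θ ^ (m + n) := by ring

namespace IsBoundedSolution

variable {M lam Lam : ℝ} {K u : Plane → ℝ}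

lemma areaDensity_eq (H : IsBoundedSolution M lam Lam K u) {R : ℝ} (hR : 0 ≤ R) (x : Plane) :
    areaDensity u (square R x) = ENNReal.ofReal (area u R x) / ENNReal.ofReal (R ^ 2) := by
  rw [areaDensity, volume_square hR, area, ofReal_integral_eq_lintegral_ofReal
    (H.integrableOn_exp R x) (ae_of_all _ fun _ => (Real.exp_pos _).le)]

end IsBoundedSolution

/-! ### Power decay -/

/-- Power decay of the areas of squares, uniformly over all bounded solutions. -/
lemma exists_area_bound (M lam Lam : ℝ) (hlam : 0 < lam) :
    ∃ ε C : ℝ, 0 < ε ∧ 0 < C ∧ ∀ K u : Plane → ℝ, IsBoundedSolution M lam Lam K u →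
      ∀ R : ℝ, 1 ≤ R → ∀ x, area u R x ≤ C * R ^ (-ε) * R ^ 2 := by
  obtain ⟨l, hl⟩ := pow_unbounded_of_one_lt (1024 * IsBoundedSolution.heightConst M Lam / lam)
    (by norm_num : (1 : ℝ) < 4)
  rw [div_lt_iff₀ hlam, mul_comm _ lam] at hl
  have hp : (0 : ℝ) < (1 / 4) ^ (l + 4) := by positivity
  have hp1 : (1 / 4 : ℝ) ^ (l + 4) ≤ 1 := pow_le_one₀ (by norm_num) (by norm_num)
  obtain ⟨θ, C, h0, h1, hC, hbound⟩ := exists_geometric_bound (l + 4)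
    (q := 1 - 1 / 2 * (1 / 4) ^ (l + 4)) (by linarith) (by linarith) (Real.exp (2 * M))
  refine ⟨-Real.logb 2 θ, 4 * C, neg_pos.2 (Real.logb_neg (by norm_num) h0 h1), by positivity,
    fun K u H R hR x => ?_⟩
  have hε : -Real.logb 2 θ > 0 := neg_pos.2 (Real.logb_neg (by norm_num) h0 h1)
  have hd := hbound _ H.dyadicDensity_antitone H.dyadicDensity_le (H.dyadicDensity_trichotomy hl)
  obtain ⟨k, hk, hk'⟩ := exists_nat_pow_near hR (by norm_num : (1 : ℝ) < 2)
  have hθ : θ ^ (k + 1) ≤ R ^ (- -Real.logb 2 θ) := by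
    calc θ ^ (k + 1) = ((2 : ℝ) ^ Real.logb 2 θ) ^ (k + 1) := by
          rw [Real.rpow_logb (by norm_num) (by norm_num) h0]
      _ = ((2 : ℝ) ^ (k + 1)) ^ Real.logb 2 θ := by
          rw [← Real.rpow_natCast, ← Real.rpow_mul (by norm_num), mul_comm, Real.rpow_mul
            (by norm_num), Real.rpow_natCast]
      _ ≤ R ^ Real.logb 2 θ :=
          Real.rpow_le_rpow_of_nonpos (by linarith) hk'.le (by linarith)
      _ = _ := by rw [neg_neg]
  calc area u R x ≤ area u (2 ^ (k + 1)) x :=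
        H.area_mono (square_subset_square fun i => by simp only [sub_self, abs_zero]; linarith)
    _ ≤ dyadicDensity u (k + 1) * 4 ^ (k + 1) := H.area_le_dyadicDensity _ x
    _ ≤ (C * θ ^ (k + 1)) * 4 ^ (k + 1) := by gcongr; exact hd _
    _ ≤ (C * R ^ (- -Real.logb 2 θ)) * (4 * R ^ 2) := by
        gcongr
        rw [pow_succ', show (4 : ℝ) = 2 ^ 2 by norm_num, ← pow_mul, mul_comm 2 k, pow_mul]
        gcongr
    _ = 4 * C * R ^ (- -Real.logb 2 θ) * R ^ 2 := by ring

theorem theorem1p2 (M lam Lam : ℝ) (hlam : 0 < lam) :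
    ∃ ε C : ℝ, 0 < ε ∧ 0 < C ∧
      ∀ K u : Plane → ℝ,
        AEMeasurable K volume →
        (∀ᵐ x, lam ≤ K x ∧ K x ≤ Lam) →
        (∀ᵐ x, u x ≤ M) →
        IsEntireSolution K u →
        (∀ R : ℝ, 1 ≤ R → globalDensity u R ≤ ENNReal.ofReal (C * R ^ (-ε))) ∧
        (∀ R : ℝ, IntegrableOn (fun x => Real.exp (2 * u x)) (Metric.ball 0 R) volume) ∧
        (fun R : ℝ => ∫ x in Metric.ball (0 : Plane) R, Real.exp (2 * u x))
          =O[atTop] (fun R : ℝ => R ^ (2 - ε)) := by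
  obtain ⟨ε, C, hε, hC, hbound⟩ := exists_area_bound M lam Lam hlam
  refine ⟨ε, C, hε, hC, fun K u _ hK hu hsol => ?_⟩
  have H : IsBoundedSolution M lam Lam K u :=
    ⟨hlam, hK.mono fun _ h => h.1, hK.mono fun _ h => h.2, hu, hsol⟩
  refine ⟨fun R hR => iSup_le fun x => ?_, fun R => ?_, ?_⟩
  · have hR0 : 0 < R := by linarith
    rw [H.areaDensity_eq hR0.le]
    refine ENNReal.div_le_of_le_mul ?_
    rw [← ENNReal.ofReal_mul (by positivity)]
    exact ENNReal.ofReal_le_ofReal (hbound K u H R hR x)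
  · exact (H.locallyIntegrable_exp.integrableOn_isCompact (isCompact_closedBall 0 R)).mono_set
      Metric.ball_subset_closedBall
  · refine Asymptotics.IsBigO.of_bound (4 * C) ?_
    filter_upwards [eventually_ge_atTop 1] with R hR
    have hR0 : 0 < R := by linarith
    have hball : Metric.ball (0 : Plane) R ⊆ square (2 * R) 0 := by
      intro y hy
      rw [Metric.mem_ball, dist_eq_norm] at hy
      refine mem_square_of_norm_sq_le (by positivity) ?_
      have := norm_nonneg (y - 0)
      gcongr
      linarith
    rw [Real.norm_of_nonneg (integral_nonneg fun _ => (Real.exp_pos _).le),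
      Real.norm_of_nonneg (by positivity)]
    calc ∫ x in Metric.ball (0 : Plane) R, Real.exp (2 * u x) ≤ area u (2 * R) 0 :=
          setIntegral_mono_set (H.integrableOn_exp _ _) (ae_of_all _ fun _ => (Real.exp_pos _).le)
            hball.eventuallyLE
      _ ≤ C * (2 * R) ^ (-ε) * (2 * R) ^ 2 := hbound K u H _ (by linarith) 0
      _ ≤ C * R ^ (-ε) * (2 * R) ^ 2 := by
          gcongr ?_ * ?_
          exact mul_le_mul_of_nonneg_left
            (Real.rpow_le_rpow_of_nonpos hR0 (by linarith) (by linarith)) hC.le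
      _ = 4 * C * R ^ (2 - ε) := by
          rw [sub_eq_add_neg, Real.rpow_add hR0, Real.rpow_two]
          ring
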